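/- Let $\zeta(a,x)$ be the Hurwitz zeta function, that is $\sum_{k\ge 0}(k+x)^{-a}$ for $\Re a>1$, $0<x\le 1$, continued analytically to $a\in\mathbb C\setminus\{1\}$, and let $\zeta(a)=\zeta(a,1)$ be the Riemann zeta function. Put $\zeta_1(a,x)=\zeta(a,x)-x^{-a}$, extended continuously to $x=0$ by $\zeta_1(a,0)=\zeta(a)$. Let $B(x,y)=\Gamma(x)\Gamma(y)/\Gamma(x+y)$ and $(a)_n=a(a+1)\cdots(a+n-1)$, $(a)_0=1$. For $a,b\ne 1$ let $$J(a,b)=\int_0^1\zeta_1(a,x)\,\zeta_1(b,1-x)\,dx .$$ (1) For $0<\Re a<1$ and $0<\Re b<1$ the integral and both series below converge absolutely, and $$J(a,b)=B(1-a,1-b)\{\zeta(a+b-1)-1\}-\sum_{n=0}^\infty\frac{(a)_n}{n!}\,\frac{\zeta(a+n)-1}{n+1-b}-\sum_{n=0}^\infty\frac{(b)_n}{n!}\,\frac{\zeta(b+n)-1}{n+1-a}.\qquad(*)$$ (2) The right-hand side of $(*)$ provides the analytic continuation of $J(a,b)$, in particular into $\Re a>1$, $\Re b>1$, both sides being analytic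 functions of $(a,b)$ except at $a=1$ and $b=1$. Precisely: the integral $J(a,b)$ converges and is analytic in $(a,b)$ on $\Omega=\{(a,b)\in\mathbb C^2: a\ne1,\ b\ne1\}$. On the set $U$ of all $(a,b)\in\mathbb C^2$ with $a,b\notin\mathbb Z$ and $a+b\ne2$ the series converge absolutely, the right-hand side of $(*)$ is analytic and $(*)$ holds; so $(*)$ holds for all $\Re a,\Re b>1$ with $a,b\notin\{2,3,\dots\}$. At every point of $\Omega\setminus U$ (for instance where $a$ or $b$ is one of $2,3,\dots$) the singularity of the right-hand side is only apparent: it tends to $J(a_0,b_0)$ as $(a,b)\in U$ tends to $(a_0,b_0)\in\Omega$. (3) At $a=1$ and $b=1$ there is a double pole: $J(a,b)=F(a,b)/\big((a-1)(b-1)\big)$ on $\Omega$ with $F$ entire on $\mathbb C^2$ and $F(a,b)\ne0$ whenever $a=1$ or $b=1$. -/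

import Mathlib

noncomputable section

/-- The auxiliary zeta function `ζ₁(a,x) = ζ(a,x) - x^{-a}` for `x ∈ (0,1]`, where `ζ(a,x)` is the
analytically continued Hurwitz zeta function. Mathlib's Hurwitz zeta function has its second
argument on the circle `ℝ/ℤ` and is `∑_{k ≥ 0} (k + x)^{-a}` for `Re a > 1` and `x ∈ (0,1]`. -/
def auxZeta (a : ℂ) (x : ℝ) : ℂ :=
  HurwitzZeta.hurwitzZeta (x : UnitAddCircle) a - (x : ℂ) ^ (-a)

/-- The integrand `ζ₁(a,x) ζ₁(b,1-x)`. -/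
def auxIntegrand (a b : ℂ) (x : ℝ) : ℂ :=
  auxZeta a x * auxZeta b (1 - x)

/-- `J(a,b) = ∫₀¹ ζ₁(a,x) ζ₁(b,1-x) dx`. -/
def auxIntegral (a b : ℂ) : ℂ :=
  ∫ x in (0 : ℝ)..1, auxIntegrand a b x

/-- The beta function `B(x,y) = Γ(x) Γ(y) / Γ(x+y)`, with `1 / Γ` read as the entire function
vanishing at the nonpositive integers (which agrees with division by `Complex.Gamma`). -/
def gammaBeta (x y : ℂ) : ℂ :=
  Complex.Gamma x * Complex.Gamma y / Complex.Gamma (x + y)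

/-- The term `((a)ₙ / n!) (ζ(a+n) - 1) / (n + 1 - b)`, with `(a)ₙ = a (a+1) ⋯ (a+n-1)`. -/
def auxTerm (a b : ℂ) (n : ℕ) : ℂ :=
  (ascPochhammer ℂ n).eval a / (n.factorial : ℂ) *
    ((riemannZeta (a + n) - 1) / ((n : ℂ) + 1 - b))

/-- The closed expression
`B(1-a,1-b) {ζ(a+b-1) - 1} - ∑ₙ auxTerm a b n - ∑ₙ auxTerm b a n`. -/
def auxClosed (a b : ℂ) : ℂ :=
  gammaBeta (1 - a) (1 - b) * (riemannZeta (a + b - 1) - 1)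
    - (∑' n : ℕ, auxTerm a b n) - (∑' n : ℕ, auxTerm b a n)

/-- The pairs `(a,b)` with `a ≠ 1` and `b ≠ 1`. -/
def poleFree : Set (ℂ × ℂ) :=
  {p | p.1 ≠ 1 ∧ p.2 ≠ 1}

/-- The pairs `(a,b)` at which every single quantity of the closed expression is finite:
neither `a` nor `b` is an integer, and `a + b ≠ 2`. -/
def regularPairs : Set (ℂ × ℂ) :=
  {p | (∀ k : ℤ, p.1 ≠ k) ∧ (∀ k : ℤ, p.2 ≠ k) ∧ p.1 + p.2 ≠ 2}

end

/-!
# Mikolás' integral for the auxiliary Hurwitz zeta function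

Write `ζ₁(a, 1 - x) = ∑_{k ≥ 0} (k + 2 - x) ^ (-a)` for `Re a > 1` and expand each term by the binomial
series in `x`:
`(a - 1) ζ₁(a, 1 - x) = ∑ₙ cₙ(a) xⁿ`, where `cₙ(a) = (a - 1) (a)ₙ / n! (ζ(a + n) - 1)`.
Each `cₙ` extends to an entire function `taylorCoeff n`: the factor `a + n - 1` of `(a - 1) (a)ₙ`
cancels the pole of `ζ(a + n)`. As `ζ(s) - 1` decays like `2 ^ (-Re s)`, the `cₙ` have a summable
bound, locally uniformly in `a` (`exists_summable_norm_taylorCoeff_le`). Hence the series converges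
in the Banach space `C([0,1], ℂ)` and is an entire function `taylorMap` of `a` with values there, and
by the identity theorem it represents `(a - 1) ζ₁(a, 1 - x)` for all `a ≠ 1`
(`auxZeta_eq_taylorMap`). Consequently `(a - 1) (b - 1) J(a, b)` is the value at
`(taylorMap a, taylorMap b)` of a continuous bilinear form, so it is entire in `(a, b)`
(`regIntegral`, `analyticAt_regIntegral`). On the line `b = 1` one has `taylorMap 1 = 1`, and what is
left is a telescoping integral with value `1` (`regIntegral_one_right`).

For `Re a, Re b < 0`, Hurwitz' formula gives absolutely convergent Fourier series of `ζ(a, x)` and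
`ζ(b, 1 - x)`, and orthogonality together with the functional equation of `ζ` gives
`∫₀¹ ζ(a, x) ζ(b, 1 - x) dx = B(1 - a, 1 - b) ζ(a + b - 1)`
(`integral_hurwitzZeta_mul_hurwitzZeta`). Substituting `ζ(a, x) = ζ₁(a, x) + x ^ (-a)`, the mixed
terms are integrated termwise and become the two series, and the product of the two powers gives the
beta function (`auxIntegral_eq_auxClosed_of_re_neg`). The identity is then continued in one variable
at a time, first in `a`, then in `b`; this needs only the analyticity of the closed expression in
each variable separately (`auxIntegral_eq_auxClosed`). Its joint analyticity, and its limits at the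
apparent singularities, are those of the integral.
-/

open Complex Filter Topology Set
open scoped Real

/-! ### The binomial series -/

theorem hasSum_ascPochhammer_mul_pow (a : ℂ) {z : ℂ} (hz : ‖z‖ < 1) :
    HasSum (fun n : ℕ ↦ (ascPochhammer ℂ n).eval a / (n.factorial : ℂ) * z ^ n)
      ((1 - z) ^ (-a)) := by
  have h := (one_div_one_sub_cpow_hasFPowerSeriesOnBall_zero a).hasSum (y := z)
    (by simpa [enorm_eq_nnnorm, ← NNReal.coe_lt_coe] using hz)
  simp only [zero_add, one_div, ← cpow_neg] at h
  refine h.congr_fun fun n ↦ ?_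
  have h1 := Ring.factorial_nsmul_multichoose_eq_ascPochhammer a n
  rw [nsmul_eq_mul, Polynomial.ascPochhammer_smeval_eq_eval] at h1
  have h2 : Ring.choose (a + n - 1) n = Ring.multichoose a n := by
    rw [Ring.choose]; congr 1; ring
  have h3 : (n.factorial : ℂ) ≠ 0 := by exact_mod_cast n.factorial_ne_zero
  simp only [FormalMultilinearSeries.ofScalars_apply_eq, h2, ← h1, smul_eq_mul]
  field_simp

theorem norm_ascPochhammer_eval_le {a : ℂ} {R : ℝ} (ha : ‖a‖ ≤ R) (n : ℕ) :
    ‖(ascPochhammer ℂ n).eval a‖ ≤ (ascPochhammer ℝ n).eval R := by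
  have hR : 0 ≤ R := (norm_nonneg a).trans ha
  induction n with
  | zero => simp
  | succ n ih =>
    rw [ascPochhammer_succ_eval, ascPochhammer_succ_eval, norm_mul]
    have : ‖a + n‖ ≤ R + n := (norm_add_le _ _).trans (by simpa using ha)
    gcongr
    exact (norm_nonneg _).trans ih

theorem summable_ascPochhammer_mul_pow (R : ℝ) {r : ℝ} (hr : |r| < 1) :
    Summable fun n : ℕ ↦ (ascPochhammer ℝ n).eval R / (n.factorial : ℝ) * r ^ n := by
  have h := (hasSum_ascPochhammer_mul_pow (R : ℂ) (z := (r : ℂ)) (by simpa using hr)).summable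
  refine Complex.summable_ofReal.mp (h.congr fun n ↦ ?_)
  have := Polynomial.eval_map_apply (f := ofRealHom) (p := ascPochhammer ℝ n) (x := R)
  rw [ascPochhammer_map] at this
  push_cast
  rw [← ofRealHom_eq_coe R, this]
  rfl

theorem ascPochhammer_eval_mul_eq (a : ℂ) (n : ℕ) :
    (a - 1) * (ascPochhammer ℂ n).eval a = (ascPochhammer ℂ n).eval (a - 1) * (a - 1 + n) := by
  rw [← ascPochhammer_succ_eval, ascPochhammer_succ_left]
  simp

/-! ### The Riemann zeta function without its pole and its first term -/

/-- The entire function that extends `(s - 1) (ζ(s) - 1)`; its value at the pole `s = 1` of `ζ` is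
the residue `1`. -/
noncomputable def zetaReg : ℂ → ℂ :=
  Function.update (fun s ↦ (s - 1) * (riemannZeta s - 1)) 1 1

theorem zetaReg_of_ne {s : ℂ} (hs : s ≠ 1) : zetaReg s = (s - 1) * (riemannZeta s - 1) :=
  Function.update_of_ne hs ..

theorem zetaReg_one : zetaReg 1 = 1 := Function.update_self ..

theorem differentiable_zetaReg : Differentiable ℂ zetaReg := by
  intro s
  rcases eq_or_ne s 1 with rfl | hs
  · refine (analyticAt_of_differentiable_on_punctured_nhds_of_continuousAt ?_ ?_).differentiableAt
    · filter_upwards [self_mem_nhdsWithin] with s hs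
      refine DifferentiableAt.congr_of_eventuallyEq (f := fun s ↦ (s - 1) * (riemannZeta s - 1)) ?_ ?_
      · exact (differentiableAt_id.sub_const 1).mul ((differentiableAt_riemannZeta hs).sub_const 1)
      · filter_upwards [isOpen_ne.mem_nhds hs] with t ht using zetaReg_of_ne ht
    · rw [zetaReg, continuousAt_update_same]
      have h1 : Tendsto (fun s : ℂ ↦ s - 1) (𝓝[≠] 1) (𝓝 0) := by
        have : ContinuousAt (fun s : ℂ ↦ s - 1) 1 := by fun_prop
        simpa [ContinuousAt] using this.tendsto.mono_left nhdsWithin_le_nhds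
      simpa [mul_sub] using riemannZeta_residue_one.sub h1
  · refine DifferentiableAt.congr_of_eventuallyEq (f := fun s ↦ (s - 1) * (riemannZeta s - 1)) ?_ ?_
    · exact (differentiableAt_id.sub_const 1).mul ((differentiableAt_riemannZeta hs).sub_const 1)
    · filter_upwards [isOpen_ne.mem_nhds hs] with t ht using zetaReg_of_ne ht

theorem hasSum_riemannZeta_sub_one {s : ℂ} (hs : 1 < s.re) :
    HasSum (fun k : ℕ ↦ (k + 2 : ℂ) ^ (-s)) (riemannZeta s - 1) := by
  have h : Summable fun n : ℕ ↦ 1 / (n : ℂ) ^ s := Complex.summable_one_div_nat_cpow.mpr hs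
  have h1 := (hasSum_nat_add_iff' 2).mpr h.hasSum
  rw [← zeta_eq_tsum_one_div_nat_cpow hs] at h1
  have h0 : s ≠ 0 := fun h0 ↦ by simp [h0] at hs; linarith
  simpa [Finset.sum_range_succ, h0, cpow_neg] using h1

theorem norm_add_two_cpow_neg (k : ℕ) (s : ℂ) :
    ‖(k + 2 : ℂ) ^ (-s)‖ = (k + 2 : ℝ) ^ (-s.re) := by
  rw [show (k + 2 : ℂ) = ((k + 2 : ℝ) : ℂ) by push_cast; rfl,
    norm_cpow_eq_rpow_re_of_pos (by positivity), neg_re]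

theorem summable_add_two_rpow_neg {σ : ℝ} (hσ : 1 < σ) :
    Summable fun k : ℕ ↦ (k + 2 : ℝ) ^ (-σ) := by
  have := (hasSum_riemannZeta_sub_one (s := σ) (by simpa using hσ)).summable.norm
  simpa [norm_add_two_cpow_neg] using this

/-- Only the terms `m ^ (-s)` with `m ≥ 2` enter into `ζ(s) - 1`, which therefore decays like
`2 ^ (-Re s)`. -/
theorem exists_norm_riemannZeta_sub_one_le :
    ∃ C : ℝ, 0 ≤ C ∧ ∀ s : ℂ, 2 ≤ s.re → ‖riemannZeta s - 1‖ ≤ C * 2 ^ (-s.re) := by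
  refine ⟨(∑' k : ℕ, (k + 2 : ℝ) ^ (-2 : ℝ)) * 4, by positivity, fun s hs ↦ ?_⟩
  have h1 := hasSum_riemannZeta_sub_one (s := s) (by linarith)
  have h2 : Summable fun k : ℕ ↦ (k + 2 : ℝ) ^ (-2 : ℝ) := summable_add_two_rpow_neg (by norm_num)
  rw [← h1.tsum_eq]
  refine tsum_of_norm_bounded ((h2.hasSum.mul_right 4).mul_right _) fun k ↦ ?_
  have h4 : (4 : ℝ) * 2 ^ (-s.re) = 2 ^ (-s.re + 2) := by
    rw [Real.rpow_add two_pos]; norm_num [mul_comm]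
  have h5 : (k + 2 : ℝ) ^ (-s.re) = (k + 2 : ℝ) ^ (-2 : ℝ) * (k + 2 : ℝ) ^ (-s.re + 2) := by
    rw [← Real.rpow_add (by positivity)]; ring_nf
  rw [norm_add_two_cpow_neg, mul_assoc, h4, h5]
  refine mul_le_mul_of_nonneg_left ?_ (by positivity)
  exact Real.rpow_le_rpow_of_nonpos two_pos (by linarith [k.cast_nonneg (α := ℝ)]) (by linarith)

/-- For `Re (a + n) ≥ 2` this is the decay of `ζ(s) - 1`; the other `a + n` stay in a fixed disc, where
`zetaReg` is bounded by compactness. -/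
theorem exists_norm_zetaReg_add_natCast_le {R : ℝ} (hR : 1 ≤ R) :
    ∃ C : ℝ, 0 ≤ C ∧ ∀ a : ℂ, ‖a - 1‖ ≤ R → ∀ n : ℕ,
      ‖zetaReg (a + n)‖ ≤ C * ((R + n) * (1 / 2) ^ n) := by
  obtain ⟨C₁, hC₁, h₁⟩ := exists_norm_riemannZeta_sub_one_le
  obtain ⟨C₂, h₂⟩ := (isCompact_closedBall (1 : ℂ) (R + (1 + R))).exists_bound_of_continuousOn
    differentiable_zetaReg.continuous.continuousOn
  have hC₂ : 0 ≤ C₂ := (norm_nonneg _).trans (h₂ 1 (Metric.mem_closedBall_self (by linarith)))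
  refine ⟨C₁ * 2 ^ R + C₂ * 2 ^ (1 + R), by positivity, fun a ha n ↦ ?_⟩
  have hn : ‖a + n - 1‖ ≤ R + n := by
    rw [add_sub_right_comm]
    exact (norm_add_le _ _).trans (by simpa using ha)
  have hre : 1 - a.re ≤ R := by
    have := (abs_re_le_norm (a - 1)).trans ha
    simp only [sub_re, one_re] at this
    linarith [(abs_le.mp this).1]
  have hpow : ((1 : ℝ) / 2) ^ n = 2 ^ (-(n : ℝ)) := by
    rw [Real.rpow_neg two_pos.le, Real.rpow_natCast, one_div, inv_pow]
  have hn0 : (0 : ℝ) ≤ n := n.cast_nonneg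
  rw [add_mul]
  rcases le_or_gt 2 (a + n).re with h | h
  · have hne : a + n ≠ 1 := fun h1 ↦ by rw [h1] at h; norm_num at h
    rw [zetaReg_of_ne hne, norm_mul]
    refine le_add_of_le_of_nonneg ?_ (by positivity)
    calc _ ≤ (R + n) * (C₁ * 2 ^ (-(a + n).re)) := by gcongr; exact h₁ _ h
      _ ≤ (R + n) * (C₁ * 2 ^ (R + -(n : ℝ))) := by
        gcongr
        · norm_num
        · simp; linarith
      _ = _ := by rw [hpow, Real.rpow_add two_pos]; ring
  · have hn1 : (n : ℝ) ≤ 1 + R := by simp at h; linarith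
    refine le_add_of_nonneg_of_le (by positivity) ?_
    calc ‖zetaReg (a + n)‖ ≤ C₂ := h₂ _ (by
          rw [mem_closedBall_iff_norm]; exact hn.trans (by linarith))
      _ = C₂ * (1 * 1) := by ring
      _ ≤ C₂ * ((R + n) * 2 ^ (1 + R - n)) := by
        gcongr
        · linarith
        · exact Real.one_le_rpow one_le_two (by linarith)
      _ = _ := by rw [hpow, sub_eq_add_neg, Real.rpow_add two_pos]; ring

/-! ### The Taylor coefficients of the auxiliary zeta function -/

/-- The coefficients of the Taylor expansion `(a - 1) ζ₁(a, 1 - x) = ∑ₙ taylorCoeff n a * xⁿ`.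
Where `ζ(a + n)` is finite they are `(a - 1) (a)ₙ / n! (ζ(a + n) - 1)`. -/
noncomputable def taylorCoeff (n : ℕ) (a : ℂ) : ℂ :=
  (ascPochhammer ℂ n).eval (a - 1) / (n.factorial : ℂ) * zetaReg (a + n)

theorem taylorCoeff_eq {n : ℕ} {a : ℂ} (h : a + n ≠ 1) :
    taylorCoeff n a =
      (a - 1) * ((ascPochhammer ℂ n).eval a / (n.factorial : ℂ) * (riemannZeta (a + n) - 1)) := by
  rw [taylorCoeff, zetaReg_of_ne h]
  linear_combination -(riemannZeta (a + n) - 1) / (n.factorial : ℂ) *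
    ascPochhammer_eval_mul_eq a n

theorem differentiable_taylorCoeff (n : ℕ) : Differentiable ℂ (taylorCoeff n) := by
  refine Differentiable.mul ?_ (differentiable_zetaReg.comp (differentiable_id.add_const _))
  exact ((ascPochhammer ℂ n).differentiable.comp (differentiable_id.sub_const 1)).div_const _

theorem exists_summable_norm_taylorCoeff_le (R : ℝ) :
    ∃ M : ℕ → ℝ, Summable M ∧ ∀ a : ℂ, ‖a - 1‖ ≤ R → ∀ n, ‖taylorCoeff n a‖ ≤ M n := by
  wlog hR : 1 ≤ R generalizing R
  · obtain ⟨M, hM, h⟩ := this 1 le_rfl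
    exact ⟨M, hM, fun a ha ↦ h a (by linarith)⟩
  obtain ⟨C, hC, h⟩ := exists_norm_zetaReg_add_natCast_le hR
  refine ⟨fun n ↦ C * R * ((ascPochhammer ℝ n).eval (R + 1) / (n.factorial : ℝ) * (1 / 2) ^ n),
    (summable_ascPochhammer_mul_pow (R + 1) (by norm_num [abs_of_pos])).mul_left _,
    fun a ha n ↦ ?_⟩
  rw [taylorCoeff, norm_mul, norm_div, norm_natCast]
  have h1 : (ascPochhammer ℝ n).eval R * (R + n) = R * (ascPochhammer ℝ n).eval (R + 1) := by
    rw [← ascPochhammer_succ_eval, ascPochhammer_succ_left]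
    simp
  calc _ ≤ (ascPochhammer ℝ n).eval R / n.factorial * (C * ((R + n) * (1 / 2) ^ n)) := by
        gcongr
        · exact div_nonneg ((norm_nonneg _).trans (norm_ascPochhammer_eval_le ha n)) (by positivity)
        · exact norm_ascPochhammer_eval_le ha n
        · exact h a ha n
    _ = _ := by linear_combination C * (1 / 2) ^ n / n.factorial * h1

theorem summable_norm_taylorCoeff (a : ℂ) : Summable fun n ↦ ‖taylorCoeff n a‖ := by
  obtain ⟨M, hM, h⟩ := exists_summable_norm_taylorCoeff_le ‖a - 1‖
  exact hM.of_nonneg_of_le (fun _ ↦ norm_nonneg _) (h a le_rfl)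

theorem differentiable_tsum_taylorCoeff_smul {E : Type*} [NormedAddCommGroup E] [NormedSpace ℂ E]
    [CompleteSpace E] (e : ℕ → E) {K : ℝ} (he : ∀ n, ‖e n‖ ≤ K) :
    Differentiable ℂ fun a ↦ ∑' n, taylorCoeff n a • e n := by
  intro a
  obtain ⟨M, hM, h⟩ := exists_summable_norm_taylorCoeff_le (‖a - 1‖ + 1)
  refine (Complex.differentiableOn_tsum_of_summable_norm (U := Metric.ball a 1)
    (hM.mul_right K) (fun n ↦ ((differentiable_taylorCoeff n).smul_const _).differentiableOn)
    Metric.isOpen_ball fun n w hw ↦ ?_).differentiableAt (Metric.ball_mem_nhds a one_pos)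
  rw [norm_smul]
  refine mul_le_mul (h w ?_ n) (he n) (norm_nonneg _) ((norm_nonneg _).trans (h w ?_ n))
  all_goals
    rw [mem_ball_iff_norm] at hw
    calc ‖w - 1‖ = ‖(a - 1) + (w - a)‖ := by congr 1; ring
      _ ≤ _ := (norm_add_le _ _).trans (by linarith)

/-- For `Re a > 1` the Taylor expansion is the binomial series, applied to each term
`(k + 2 - x) ^ (-a)` of the Dirichlet series of `ζ₁(a, 1 - x)`. -/
theorem hasSum_taylorCoeff_of_one_lt_re {a : ℂ} (ha : 1 < a.re) {x : ℝ} (hx : x ∈ Icc (0 : ℝ) 1) :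
    HasSum (fun n ↦ taylorCoeff n a * (x : ℂ) ^ n)
      ((a - 1) * ∑' k : ℕ, (k + 2 - x : ℂ) ^ (-a)) := by
  -- The row sums of `f` are the terms of the Dirichlet series, its column sums the Taylor terms.
  set f : ℕ × ℕ → ℂ := fun p ↦
    (p.1 + 2 : ℂ) ^ (-a) * ((ascPochhammer ℂ p.2).eval a / (p.2.factorial : ℂ) *
      (x / (p.1 + 2)) ^ p.2) with hf
  have hne (k : ℕ) : (k + 2 : ℂ) ≠ 0 := by exact_mod_cast (by positivity : ((k + 2 : ℕ) : ℝ) ≠ 0)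
  have hnorm (k : ℕ) : ‖(x / (k + 2) : ℂ)‖ ≤ 1 / 2 := by
    rw [show (x / (k + 2) : ℂ) = ((x / (k + 2) : ℝ) : ℂ) by push_cast; rfl, norm_real,
      Real.norm_of_nonneg (div_nonneg hx.1 (by positivity))]
    exact div_le_div₀ zero_le_one hx.2 two_pos (by linarith [k.cast_nonneg (α := ℝ)])
  -- As `x / (k + 2) ≤ 1 / 2`, the double series is dominated by a product of two convergent series.
  have hsum : Summable f := by
    have h1 := summable_add_two_rpow_neg ha
    have h2 := summable_ascPochhammer_mul_pow ‖a‖ (r := 1 / 2) (by norm_num [abs_of_pos])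
    have h3 (n : ℕ) : 0 ≤ (ascPochhammer ℝ n).eval ‖a‖ :=
      (norm_nonneg _).trans (norm_ascPochhammer_eval_le le_rfl n)
    refine Summable.of_norm_bounded (h1.mul_of_nonneg h2 (fun _ ↦ ?_) fun n ↦ ?_) fun p ↦ ?_
    · exact Real.rpow_nonneg (by positivity) _
    · exact mul_nonneg (div_nonneg (h3 n) (by positivity)) (by positivity)
    · rw [norm_mul, norm_mul, norm_pow, norm_div, norm_natCast, norm_add_two_cpow_neg]
      have := h3 p.2
      gcongr
      · exact norm_ascPochhammer_eval_le le_rfl _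
      · exact hnorm _
  have hrow (k : ℕ) : HasSum (fun n ↦ f (k, n)) ((k + 2 - x : ℂ) ^ (-a)) := by
    have h := (hasSum_ascPochhammer_mul_pow a (z := x / (k + 2))
      ((hnorm k).trans_lt (by norm_num))).mul_left ((k + 2 : ℂ) ^ (-a))
    convert! h using 1
    have hk : (0 : ℝ) ≤ k := k.cast_nonneg
    have e1 : (1 - x / (k + 2) : ℂ) = ((1 - x / (k + 2) : ℝ) : ℂ) := by push_cast; rfl
    have e2 : (k + 2 : ℂ) = ((k + 2 : ℝ) : ℂ) := by push_cast; rfl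
    have e3 : 0 ≤ 1 - x / (k + 2) := by
      rw [sub_nonneg, div_le_one (by positivity)]; linarith [hx.2]
    rw [e1, e2, ← mul_cpow_ofReal_nonneg (by positivity) e3]
    congr 1
    push_cast
    field_simp [hne k]
  have hcol (n : ℕ) : HasSum (fun k ↦ f (k, n))
      ((ascPochhammer ℂ n).eval a / (n.factorial : ℂ) * (riemannZeta (a + n) - 1) * x ^ n) := by
    have h := (hasSum_riemannZeta_sub_one (s := a + n) (by simp; linarith [n.cast_nonneg (α := ℝ)])
      ).mul_left ((ascPochhammer ℂ n).eval a / (n.factorial : ℂ) * (x : ℂ) ^ n)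
    convert! h using 1
    · ext k
      simp only [hf]
      rw [neg_add, cpow_add _ _ (hne k), cpow_neg _ (n : ℂ), cpow_natCast, div_pow]
      ring
    · ring
  have h1 := hsum.hasSum.prod_fiberwise hrow
  have h2 : HasSum (f ∘ Prod.swap) (∑' p, f p) := (Equiv.prodComm ℕ ℕ).hasSum_iff.mpr hsum.hasSum
  have h3 := (h2.prod_fiberwise hcol).mul_left (a - 1)
  rw [h1.tsum_eq]
  refine h3.congr_fun fun n ↦ ?_
  rw [taylorCoeff_eq]
  · ring
  · intro h
    have := congrArg re h
    simp at this
    linarith [n.cast_nonneg (α := ℝ)]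

/-! ### The auxiliary zeta function as a holomorphic family in `C([0,1], ℂ)` -/

section

open scoped unitInterval
open unitInterval (symm_symm continuous_symm)

/-- The monomial `x ↦ xⁿ` in the Banach space `C([0,1], ℂ)`. -/
noncomputable def unitMonomial (n : ℕ) : C(I, ℂ) := ⟨fun x ↦ ((x : ℝ) : ℂ) ^ n, by fun_prop⟩

theorem norm_unitMonomial_le (n : ℕ) : ‖unitMonomial n‖ ≤ 1 := by
  rw [ContinuousMap.norm_le _ zero_le_one]
  intro x
  simp only [unitMonomial, ContinuousMap.coe_mk, norm_pow, norm_real, Real.norm_of_nonneg x.2.1]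
  exact pow_le_one₀ x.2.1 x.2.2

/-- The function `x ↦ ∑ₙ taylorCoeff n a * xⁿ`, which is `(a - 1) ζ₁(a, 1 - x)`, as an element of
the Banach space `C([0,1], ℂ)`; as such it is an entire function of `a`. -/
noncomputable def taylorMap (a : ℂ) : C(I, ℂ) := ∑' n, taylorCoeff n a • unitMonomial n

theorem differentiable_taylorMap : Differentiable ℂ taylorMap :=
  differentiable_tsum_taylorCoeff_smul _ norm_unitMonomial_le

theorem hasSum_taylorMap (a : ℂ) (x : I) :
    HasSum (fun n ↦ taylorCoeff n a * ((x : ℝ) : ℂ) ^ n) (taylorMap a x) := by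
  have h : Summable fun n ↦ taylorCoeff n a • unitMonomial n := by
    refine Summable.of_norm_bounded (summable_norm_taylorCoeff a) fun n ↦ ?_
    rw [norm_smul]
    exact mul_le_of_le_one_right (norm_nonneg _) (norm_unitMonomial_le n)
  simpa [unitMonomial, taylorMap] using (ContinuousMap.evalCLM ℂ x).hasSum h.hasSum

theorem differentiable_taylorMap_apply (x : I) : Differentiable ℂ fun a ↦ taylorMap a x :=
  (ContinuousMap.evalCLM ℂ x : C(I, ℂ) →L[ℂ] ℂ).differentiable.comp differentiable_taylorMap

theorem Complex.one_lt_re_mem_nhds {a : ℂ} (ha : 1 < a.re) : {s : ℂ | 1 < s.re} ∈ 𝓝 a :=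
  (isOpen_lt continuous_const continuous_re).mem_nhds ha

theorem taylorMap_one (x : I) : taylorMap 1 x = 1 := by
  refine (hasSum_taylorMap 1 x).unique ?_
  convert! hasSum_ite_eq (0 : ℕ) (1 : ℂ) using 2 with n
  rcases n with _ | n
  · simp [taylorCoeff, zetaReg_one]
  · simp [taylorCoeff, ascPochhammer_succ_left]

theorem auxZeta_eq_taylorMap {a : ℂ} (ha : a ≠ 1) {x : ℝ} (hx : x ∈ Ioc (0 : ℝ) 1) (y : I)
    (hy : (y : ℝ) = 1 - x) : auxZeta a x = taylorMap a y / (a - 1) := by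
  suffices h : EqOn (fun a ↦ (a - 1) * auxZeta a x) (fun a ↦ taylorMap a y) {1}ᶜ by
    rw [eq_div_iff (sub_ne_zero.mpr ha), mul_comm]
    exact h ha
  have hx0 : (x : ℂ) ≠ 0 := by exact_mod_cast hx.1.ne'
  refine AnalyticOnNhd.eqOn_of_preconnected_of_eventuallyEq (𝕜 := ℂ) (z₀ := 2) ?_
    ((differentiable_taylorMap_apply y).differentiableOn.analyticOnNhd isOpen_compl_singleton)
    (isConnected_compl_singleton_of_one_lt_rank (by simp) 1).isPreconnected (by simp) ?_
  · refine DifferentiableOn.analyticOnNhd (fun s hs ↦ ?_) isOpen_compl_singleton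
    refine DifferentiableAt.differentiableWithinAt (.mul (by fun_prop) (.sub ?_ ?_))
    · exact HurwitzZeta.differentiableAt_hurwitzZeta _ hs
    · exact differentiableAt_id.neg.const_cpow (Or.inl hx0)
  · filter_upwards [Complex.one_lt_re_mem_nhds (a := 2) (by simp)] with s hs
    refine (HasSum.unique (hasSum_taylorMap s y) ?_).symm
    have h := hasSum_taylorCoeff_of_one_lt_re hs y.2
    convert! h using 2
    have h1 := HurwitzZeta.hasSum_hurwitzZeta_of_one_lt_re (a := x) ⟨hx.1.le, hx.2⟩ hs
    have h2 := (hasSum_nat_add_iff' 1).mpr h1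
    rw [auxZeta, hy, cpow_neg, ← one_div]
    simp only [Finset.sum_range_one, Nat.cast_zero, zero_add] at h2
    rw [← h2.tsum_eq]
    refine tsum_congr fun k ↦ ?_
    rw [cpow_neg, ← one_div]
    push_cast
    congr 2
    ring

/-! ### The integral without its poles -/

/-- Integration over `[0,1]`, as a continuous linear form on `C([0,1], ℂ)`. -/
noncomputable def unitIntegral : C(I, ℂ) →L[ℂ] ℂ :=
  LinearMap.mkContinuous
    { toFun := fun f ↦ ∫ x in (0 : ℝ)..1, f (projIcc 0 1 zero_le_one x)
      map_add' := fun f g ↦ by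
        simp only [ContinuousMap.add_apply]
        exact intervalIntegral.integral_add
          ((by fun_prop : Continuous fun x ↦ f (projIcc 0 1 zero_le_one x)).intervalIntegrable _ _)
          ((by fun_prop : Continuous fun x ↦ g (projIcc 0 1 zero_le_one x)).intervalIntegrable _ _)
      map_smul' := fun c f ↦ by simp } 1 fun f ↦ by
    have h := intervalIntegral.norm_integral_le_of_norm_le_const (a := (0 : ℝ)) (b := 1)
      (f := fun x ↦ f (projIcc 0 1 zero_le_one x)) (C := ‖f‖) fun x _ ↦ f.norm_coe_le_norm _
    simpa using h

theorem unitIntegral_apply (f : C(I, ℂ)) :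
    unitIntegral f = ∫ x in (0 : ℝ)..1, f (projIcc 0 1 zero_le_one x) := rfl

/-- The reflection `f ↦ f (1 - ·)` of `C([0,1], ℂ)`. -/
noncomputable def unitReflect : C(I, ℂ) →L[ℂ] C(I, ℂ) :=
  ⟨(ContinuousMap.compRightAlgHom ℂ ℂ ⟨σ, continuous_symm⟩).toLinearMap,
    ContinuousMap.continuous_precomp _⟩

theorem unitReflect_apply (f : C(I, ℂ)) (x : I) : unitReflect f x = f (σ x) := rfl

/-- The entire function `(a - 1) (b - 1) J(a, b)` of `(a, b)`. -/
noncomputable def regIntegral (p : ℂ × ℂ) : ℂ :=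
  unitIntegral (taylorMap p.1 * unitReflect (taylorMap p.2))

/-- `a ↦ taylorMap a` is holomorphic with values in a Banach space, hence analytic, so `regIntegral`
is the composition of a continuous bilinear map with analytic maps of one variable each. This is
what makes it jointly analytic. -/
theorem analyticAt_regIntegral (p : ℂ × ℂ) : AnalyticAt ℂ regIntegral p := by
  have h (a : ℂ) : AnalyticAt ℂ taylorMap a := differentiable_taylorMap.analyticAt a
  refine (unitIntegral.analyticAt _).comp (AnalyticAt.mul ((h p.1).comp analyticAt_fst) ?_)
  exact (unitReflect.analyticAt _).comp ((h p.2).comp analyticAt_snd)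

/-- The end points are excluded because there the formula would involve `auxZeta` at `0`, whose value
is not the continuous one. -/
theorem auxIntegrand_eq {a b : ℂ} (ha : a ≠ 1) (hb : b ≠ 1) {x : ℝ} (hx : x ∈ Ioo (0 : ℝ) 1) :
    auxIntegrand a b x =
      (unitReflect (taylorMap a) * taylorMap b) (projIcc 0 1 zero_le_one x) /
        ((a - 1) * (b - 1)) := by
  have hx' : x ∈ Icc (0 : ℝ) 1 := ⟨hx.1.le, hx.2.le⟩
  rw [auxIntegrand, projIcc_of_mem _ hx',
    auxZeta_eq_taylorMap ha ⟨hx.1, hx.2.le⟩ (σ ⟨x, hx'⟩) rfl,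
    auxZeta_eq_taylorMap hb (x := 1 - x) ⟨by linarith [hx.2], by linarith [hx.1]⟩ ⟨x, hx'⟩ (by simp),
    ContinuousMap.mul_apply, unitReflect_apply, div_mul_div_comm]

theorem intervalIntegrable_auxIntegrand {a b : ℂ} (ha : a ≠ 1) (hb : b ≠ 1) :
    IntervalIntegrable (auxIntegrand a b) MeasureTheory.volume 0 1 := by
  have h : Continuous fun x : ℝ ↦ (unitReflect (taylorMap a) * taylorMap b)
    (projIcc 0 1 zero_le_one x) / ((a - 1) * (b - 1)) := by fun_prop
  refine (h.intervalIntegrable 0 1).congr_ae ?_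
  rw [uIoc_of_le zero_le_one, ← MeasureTheory.restrict_Ioo_eq_restrict_Ioc]
  filter_upwards [MeasureTheory.ae_restrict_mem measurableSet_Ioo] with x hx
    using (auxIntegrand_eq ha hb hx).symm

theorem auxIntegral_symm (a b : ℂ) : auxIntegral a b = auxIntegral b a := by
  have h := intervalIntegral.integral_comp_sub_left (a := 0) (b := 1) (auxIntegrand b a) 1
  simp only [sub_self, sub_zero] at h
  rw [auxIntegral, auxIntegral, ← h]
  simp [auxIntegrand, mul_comm]

theorem auxIntegral_eq_regIntegral {a b : ℂ} (ha : a ≠ 1) (hb : b ≠ 1) :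
    auxIntegral a b = regIntegral (a, b) / ((a - 1) * (b - 1)) := by
  rw [auxIntegral_symm, auxIntegral, regIntegral, unitIntegral_apply,
    ← intervalIntegral.integral_div]
  refine intervalIntegral.integral_congr_ae ?_
  have h1 : ∀ᵐ x : ℝ, x ≠ 1 := by simp [MeasureTheory.ae_iff, MeasureTheory.measure_singleton]
  filter_upwards [h1] with x hx1 hx
  rw [uIoc_of_le zero_le_one] at hx
  rw [auxIntegrand_eq hb ha ⟨hx.1, lt_of_le_of_ne hx.2 hx1⟩, mul_comm (b - 1),
    mul_comm (taylorMap a)]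

theorem regIntegral_symm (a b : ℂ) : regIntegral (a, b) = regIntegral (b, a) := by
  have h := intervalIntegral.integral_comp_sub_left (a := 0) (b := 1)
    (fun x ↦ (taylorMap a * unitReflect (taylorMap b)) (projIcc 0 1 zero_le_one x)) 1
  simp only [sub_self, sub_zero] at h
  rw [regIntegral, regIntegral, unitIntegral_apply, unitIntegral_apply, ← h]
  refine intervalIntegral.integral_congr fun x hx ↦ ?_
  rw [uIcc_of_le zero_le_one] at hx
  have hσ : projIcc 0 1 zero_le_one (1 - x) = σ (projIcc 0 1 zero_le_one x) := by
    rw [projIcc_of_mem _ hx, projIcc_of_mem _ (x := 1 - x) ⟨by linarith [hx.2], by linarith [hx.1]⟩]; rfl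
  simp only [ContinuousMap.mul_apply, unitReflect_apply, hσ, symm_symm]
  ring

/-- Termwise integration of the Taylor series against a continuous weight. -/
theorem hasSum_integral_taylorMap_mul (a : ℂ) {g : ℝ → ℂ} (hg : Continuous g) :
    HasSum (fun n ↦ taylorCoeff n a * ∫ x in (0 : ℝ)..1, (x : ℂ) ^ n * g x)
      (∫ x in (0 : ℝ)..1, taylorMap a (projIcc 0 1 zero_le_one x) * g x) := by
  simp only [← intervalIntegral.integral_const_mul]
  obtain ⟨K, hK⟩ := isCompact_Icc.exists_bound_of_continuousOn (s := Icc (0 : ℝ) 1) hg.continuousOn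
  have hx {x : ℝ} (h : x ∈ uIoc (0 : ℝ) 1) : x ∈ Icc (0 : ℝ) 1 := by
    rw [uIoc_of_le zero_le_one] at h; exact ⟨h.1.le, h.2⟩
  refine intervalIntegral.hasSum_integral_of_dominated_convergence
    (fun n _ ↦ ‖taylorCoeff n a‖ * K) (fun n ↦ ?_) (fun n ↦ .of_forall fun x h ↦ ?_)
    (.of_forall fun x _ ↦ (summable_norm_taylorCoeff a).mul_right K) (by simp)
    (.of_forall fun x h ↦ ?_)
  · exact Continuous.aestronglyMeasurable (by fun_prop)
  · rw [norm_mul, norm_mul, norm_pow, norm_real, Real.norm_of_nonneg (hx h).1]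
    gcongr
    exact (mul_le_of_le_one_left (norm_nonneg _) (pow_le_one₀ (hx h).1 (hx h).2)).trans (hK x (hx h))
  · have := (hasSum_taylorMap a ⟨x, hx h⟩).mul_right (g x)
    rw [projIcc_of_mem _ (hx h)]
    simpa [mul_assoc] using this

/-- Integrating the Taylor series termwise gives
`(s - 1) ∑ₙ taylorCoeff n (s + 1) / (n + 1) = taylorMap s 1 - taylorMap s 0`, and for `Re s > 1` the
right side is `(s - 1) (ζ(s) - (ζ(s) - 1))`. -/
theorem regIntegral_one_right (a : ℂ) : regIntegral (a, 1) = 1 := by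
  have hdiff : Differentiable ℂ fun a ↦ regIntegral (a, 1) := fun a ↦
    (analyticAt_regIntegral (a, 1)).differentiableAt.comp (f := fun a : ℂ ↦ (a, (1 : ℂ))) a
      (by fun_prop)
  refine congrFun (AnalyticOnNhd.eq_of_eventuallyEq (𝕜 := ℂ) (z₀ := (3 : ℂ))
    (fun s _ ↦ hdiff.analyticAt s) (g := fun _ ↦ 1) (fun _ _ ↦ analyticAt_const) ?_) a
  filter_upwards [(isOpen_lt continuous_const continuous_re).mem_nhds
    (show (2 : ℝ) < (3 : ℂ).re by norm_num)] with t ht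
  obtain ⟨s, rfl⟩ : ∃ s, t = s + 1 := ⟨t - 1, by ring⟩
  have hs : 1 < s.re := by simp at ht; linarith
  have hs1 : s - 1 ≠ 0 := fun h ↦ by simp [sub_eq_zero.mp h] at hs
  have h0 := (hasSum_taylorCoeff_of_one_lt_re hs (x := 0) (by simp))
  have h1 := (hasSum_taylorCoeff_of_one_lt_re hs (x := 1) (by simp))
  have hz : ∑' k : ℕ, (k + 2 - (1 : ℝ) : ℂ) ^ (-s) = riemannZeta s := by
    rw [zeta_eq_tsum_one_div_nat_add_one_cpow hs]
    refine tsum_congr fun k ↦ ?_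
    rw [cpow_neg, one_div]; push_cast; congr 2; ring
  have hz' : ∑' k : ℕ, (k + 2 - (0 : ℝ) : ℂ) ^ (-s) = riemannZeta s - 1 := by
    simpa using (hasSum_riemannZeta_sub_one hs).tsum_eq
  rw [hz] at h1
  rw [hz'] at h0
  have h2 := (hasSum_nat_add_iff' 1).mpr (h1.sub h0)
  have h3 := hasSum_integral_taylorMap_mul (s + 1) (g := fun _ ↦ 1) continuous_const
  have h4 : regIntegral (s + 1, 1) =
      ∫ x in (0 : ℝ)..1, taylorMap (s + 1) (projIcc 0 1 zero_le_one x) * 1 := by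
    rw [regIntegral, unitIntegral_apply]
    simp [unitReflect_apply, taylorMap_one]
  rw [← h4] at h3
  have h5 := (h3.mul_left (s - 1)).unique (h2.congr_fun fun n ↦ ?_)
  · simp at h5
    have : (s - 1) * (regIntegral (s + 1, 1) - 1) = 0 := by linear_combination h5
    simpa [hs1, sub_eq_zero] using this
  · have hint : ∫ x in (0 : ℝ)..1, (x : ℂ) ^ n * 1 = 1 / (n + 1) := by
      have := integral_pow (a := 0) (b := 1) n
      simp only [mul_one]
      have h6 : ∀ x : ℝ, (x : ℂ) ^ n = ((x ^ n : ℝ) : ℂ) := fun x ↦ by push_cast; rfl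
      simp only [h6, intervalIntegral.integral_ofReal, this]
      simp
    rw [hint, taylorCoeff, taylorCoeff, Nat.factorial_succ, ascPochhammer_succ_left]
    have hn : (n + 1 : ℂ) ≠ 0 := by exact_mod_cast n.succ_ne_zero
    have hf : (n.factorial : ℂ) ≠ 0 := by exact_mod_cast n.factorial_ne_zero
    simp
    rw [show s + 1 + (n : ℂ) = s + (n + 1) by ring]
    field_simp

end

/-! ### Mikolás' formula for negative real parts -/

theorem norm_exp_two_pi_I_mul_div_natCast_cpow (x : ℝ) {s : ℂ} (hs : 1 < s.re) (n : ℕ) :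
    ‖cexp (2 * π * I * x * n) / (n : ℂ) ^ s‖ = 1 / (n : ℝ) ^ s.re := by
  have h0 : s.re ≠ 0 := by linarith
  rw [norm_div, norm_natCast_cpow_of_re_ne_zero _ h0,
    show (2 * π * I * x * n : ℂ) = ((2 * π * x * n : ℝ) : ℂ) * I by push_cast; ring,
    norm_exp_ofReal_mul_I]

theorem continuous_expZeta_ofReal {s : ℂ} (hs : 1 < s.re) :
    Continuous fun x : ℝ ↦ HurwitzZeta.expZeta (x : UnitAddCircle) s := by
  simp only [← (HurwitzZeta.hasSum_expZeta_of_one_lt_re _ hs).tsum_eq]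
  refine continuous_tsum (fun n ↦ by fun_prop) (Real.summable_one_div_nat_rpow.mpr hs) fun n x ↦ ?_
  exact (norm_exp_two_pi_I_mul_div_natCast_cpow x hs n).le

theorem integral_exp_two_pi_I_mul_int (k : ℤ) :
    ∫ x in (0 : ℝ)..1, cexp (2 * π * I * k * x) = if k = 0 then 1 else 0 := by
  split_ifs with h
  · simp [h]
  · have hk : (2 * π * I * k : ℂ) ≠ 0 := by simp [h, Real.pi_ne_zero]
    rw [integral_exp_mul_complex hk]
    simp [show (2 * π * I * k : ℂ) = k * (2 * π * I) by ring, exp_int_mul_two_pi_mul_I]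

theorem hasSum_integral_expZeta_mul (δ ε : ℤ) {s t : ℂ} (hs : 1 < s.re) (ht : 1 < t.re) :
    HasSum (fun p : ℕ × ℕ ↦ 1 / (p.1 : ℂ) ^ s * (1 / (p.2 : ℂ) ^ t) *
        if δ * p.1 + ε * p.2 = 0 then 1 else 0)
      (∫ x in (0 : ℝ)..1, HurwitzZeta.expZeta ((δ * x : ℝ) : UnitAddCircle) s *
        HurwitzZeta.expZeta ((ε * x : ℝ) : UnitAddCircle) t) := by
  have hS := (Real.summable_one_div_nat_rpow.mpr hs).mul_of_nonneg
    (Real.summable_one_div_nat_rpow.mpr ht) (fun n ↦ by positivity) (fun n ↦ by positivity)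
  have hnorm (x : ℝ) (p : ℕ × ℕ) :
      ‖cexp (2 * π * I * (δ * x : ℝ) * p.1) / (p.1 : ℂ) ^ s *
        (cexp (2 * π * I * (ε * x : ℝ) * p.2) / (p.2 : ℂ) ^ t)‖ =
      1 / (p.1 : ℝ) ^ s.re * (1 / (p.2 : ℝ) ^ t.re) := by
    rw [norm_mul, norm_exp_two_pi_I_mul_div_natCast_cpow _ hs,
      norm_exp_two_pi_I_mul_div_natCast_cpow _ ht]
  have hprod (x : ℝ) : HasSum (fun p : ℕ × ℕ ↦
      cexp (2 * π * I * (δ * x : ℝ) * p.1) / (p.1 : ℂ) ^ s *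
        (cexp (2 * π * I * (ε * x : ℝ) * p.2) / (p.2 : ℂ) ^ t))
      (HurwitzZeta.expZeta ((δ * x : ℝ) : UnitAddCircle) s *
        HurwitzZeta.expZeta ((ε * x : ℝ) : UnitAddCircle) t) := by
    have h1 := HurwitzZeta.hasSum_expZeta_of_one_lt_re (δ * x) hs
    have h2 := HurwitzZeta.hasSum_expZeta_of_one_lt_re (ε * x) ht
    have h3 := ((summable_congr (hnorm x)).mpr hS).of_norm
    have h4 := h1.mul h2 h3
    exact h4
  have h : HasSum (fun p : ℕ × ℕ ↦ ∫ x in (0 : ℝ)..1,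
      cexp (2 * π * I * (δ * x : ℝ) * p.1) / (p.1 : ℂ) ^ s *
        (cexp (2 * π * I * (ε * x : ℝ) * p.2) / (p.2 : ℂ) ^ t))
      (∫ x in (0 : ℝ)..1, HurwitzZeta.expZeta ((δ * x : ℝ) : UnitAddCircle) s *
        HurwitzZeta.expZeta ((ε * x : ℝ) : UnitAddCircle) t) := by
    refine intervalIntegral.hasSum_integral_of_dominated_convergence
      (fun p _ ↦ 1 / (p.1 : ℝ) ^ s.re * (1 / (p.2 : ℝ) ^ t.re)) (fun p ↦ ?_)
      (fun p ↦ .of_forall fun x _ ↦ (hnorm x p).le) (.of_forall fun _ _ ↦ hS)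
      intervalIntegrable_const (.of_forall fun x _ ↦ hprod x)
    exact Continuous.aestronglyMeasurable (by fun_prop)
  refine h.congr_fun fun p ↦ ?_
  have := integral_exp_two_pi_I_mul_int (δ * p.1 + ε * p.2)
  rw [← this, ← intervalIntegral.integral_const_mul]
  refine intervalIntegral.integral_congr fun x _ ↦ ?_
  push_cast
  rw [show (2 * π * I * (δ * p.1 + ε * p.2) * x : ℂ) =
    2 * π * I * (δ * x) * p.1 + 2 * π * I * (ε * x) * p.2 by ring, exp_add]
  ring

theorem integral_expZeta_mul_self {δ : ℤ} (hδ : δ ≠ 0) {s t : ℂ} (hs : 1 < s.re) (ht : 1 < t.re) :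
    ∫ x in (0 : ℝ)..1, HurwitzZeta.expZeta ((δ * x : ℝ) : UnitAddCircle) s *
        HurwitzZeta.expZeta ((δ * x : ℝ) : UnitAddCircle) t = 0 := by
  refine (hasSum_integral_expZeta_mul δ δ hs ht).unique (hasSum_zero.congr_fun fun p ↦ ?_)
  have hs0 : s ≠ 0 := fun h ↦ by simp [h] at hs; linarith
  split_ifs with h
  · have : p.1 = 0 := by
      rw [← mul_add, mul_eq_zero, or_iff_right hδ] at h
      omega
    simp [this, hs0]
  · simp

theorem integral_expZeta_mul_neg {δ : ℤ} (hδ : δ ≠ 0) {s t : ℂ} (hs : 1 < s.re) (ht : 1 < t.re) :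
    ∫ x in (0 : ℝ)..1, HurwitzZeta.expZeta ((δ * x : ℝ) : UnitAddCircle) s *
        HurwitzZeta.expZeta (((-δ : ℤ) * x : ℝ) : UnitAddCircle) t = riemannZeta (s + t) := by
  have h := hasSum_integral_expZeta_mul δ (-δ) hs ht
  have hs0 : s ≠ 0 := fun h ↦ by simp [h] at hs; linarith
  have hst : 1 < (s + t).re := by simp; linarith
  have hst0 : s + t ≠ 0 := fun h ↦ by simp only [h, zero_re] at hst; linarith
  have hrow (m : ℕ) : HasSum (fun n : ℕ ↦ 1 / (m : ℂ) ^ s * (1 / (n : ℂ) ^ t) *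
      if δ * (m : ℤ) + -δ * n = 0 then 1 else 0) (1 / (m : ℂ) ^ (s + t)) := by
    have h1 : 1 / (m : ℂ) ^ (s + t) = 1 / (m : ℂ) ^ s * (1 / (m : ℂ) ^ t) *
        if δ * (m : ℤ) + -δ * m = 0 then 1 else 0 := by
      rcases eq_or_ne m 0 with rfl | hm
      · simp [hst0, hs0]
      · rw [cpow_add _ _ (by exact_mod_cast hm)]
        simp
        ring
    rw [h1]
    refine hasSum_single m fun n hn ↦ ?_
    have : δ * (m : ℤ) + -δ * n ≠ 0 := by
      rw [show δ * (m : ℤ) + -δ * n = δ * (m - n) by ring]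
      exact mul_ne_zero hδ (by omega)
    rw [if_neg this, mul_zero]
  rw [zeta_eq_tsum_one_div_nat_cpow hst]
  exact (h.prod_fiberwise hrow).tsum_eq.symm

theorem hurwitzZeta_one_sub_of_one_lt_re (x : UnitAddCircle) {s : ℂ} (hs : 1 < s.re) :
    HurwitzZeta.hurwitzZeta x (1 - s) = (2 * π) ^ (-s) * Gamma s *
      (cexp (-π * I * s / 2) * HurwitzZeta.expZeta x s +
        cexp (π * I * s / 2) * HurwitzZeta.expZeta (-x) s) := by
  refine HurwitzZeta.hurwitzZeta_one_sub x (fun n h ↦ ?_) (Or.inr fun h ↦ ?_)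
  · rw [h] at hs
    simp at hs
    linarith [n.cast_nonneg (α := ℝ)]
  · simp [h] at hs

theorem continuous_hurwitzZeta_ofReal {a : ℂ} (ha : a.re < 0) :
    Continuous fun x : ℝ ↦ HurwitzZeta.hurwitzZeta (x : UnitAddCircle) a := by
  have hs : 1 < (1 - a).re := by simp; linarith
  have h (x : ℝ) := hurwitzZeta_one_sub_of_one_lt_re x hs
  simp only [sub_sub_cancel, ← AddCircle.coe_neg] at h
  simp only [h]
  have h1 := continuous_expZeta_ofReal hs
  have h2 : Continuous fun x : ℝ ↦ HurwitzZeta.expZeta ((-x : ℝ) : UnitAddCircle) (1 - a) :=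
    h1.comp continuous_neg
  fun_prop

/-- **Mikolás' formula** for negative real parts: Hurwitz' formula gives the Fourier series of both
factors, and by orthogonality only the products of conjugate exponentials contribute. -/
theorem integral_hurwitzZeta_mul_hurwitzZeta {a b : ℂ} (ha : a.re < 0) (hb : b.re < 0) :
    ∫ x in (0 : ℝ)..1, HurwitzZeta.hurwitzZeta (x : UnitAddCircle) a *
        HurwitzZeta.hurwitzZeta ((1 - x : ℝ) : UnitAddCircle) b =
      gammaBeta (1 - a) (1 - b) * riemannZeta (a + b - 1) := by
  obtain ⟨s, rfl⟩ : ∃ s, a = 1 - s := ⟨1 - a, by ring⟩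
  obtain ⟨t, rfl⟩ : ∃ t, b = 1 - t := ⟨1 - b, by ring⟩
  have hs : 1 < s.re := by simp at ha; linarith
  have ht : 1 < t.re := by simp at hb; linarith
  have hst : 1 < (s + t).re := by simp; linarith
  have h1 := integral_expZeta_mul_neg (δ := 1) one_ne_zero hs ht
  have h2 := integral_expZeta_mul_self (δ := 1) one_ne_zero hs ht
  have h3 := integral_expZeta_mul_self (δ := -1) (by norm_num) hs ht
  have h4 := integral_expZeta_mul_neg (δ := -1) (by norm_num) hs ht
  simp only [neg_neg, Int.cast_one, one_mul, Int.cast_neg, neg_one_mul] at h1 h2 h3 h4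
  have cs := continuous_expZeta_ofReal hs
  have ct := continuous_expZeta_ofReal ht
  have cs' : Continuous fun x : ℝ ↦ HurwitzZeta.expZeta ((-x : ℝ) : UnitAddCircle) s :=
    cs.comp continuous_neg
  have ct' : Continuous fun x : ℝ ↦ HurwitzZeta.expZeta ((-x : ℝ) : UnitAddCircle) t :=
    ct.comp continuous_neg
  have hfe : riemannZeta (1 - (s + t)) = _ := riemannZeta_one_sub (s := s + t)
    (fun n h ↦ by
      rw [h] at hst
      simp at hst
      linarith [n.cast_nonneg (α := ℝ)])
    (fun h ↦ by simp [h] at hst)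
  have hG : Gamma (s + t) ≠ 0 := Gamma_ne_zero_of_re_pos (by linarith)
  have hpi : (2 * π : ℂ) ≠ 0 := by simp [Real.pi_ne_zero]
  have hcos : cexp (-π * I * s / 2) * cexp (-π * I * t / 2) +
      cexp (π * I * s / 2) * cexp (π * I * t / 2) = 2 * cos (π * (s + t) / 2) := by
    rw [two_cos, ← exp_add, ← exp_add, add_comm]
    congr 2 <;> ring
  have hprod (x : ℝ) : HurwitzZeta.hurwitzZeta (x : UnitAddCircle) (1 - s) *
      HurwitzZeta.hurwitzZeta ((1 - x : ℝ) : UnitAddCircle) (1 - t) =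
      (2 * π) ^ (-s) * Gamma s * ((2 * π) ^ (-t) * Gamma t) *
        (cexp (-π * I * s / 2) * cexp (-π * I * t / 2) *
            (HurwitzZeta.expZeta (x : UnitAddCircle) s *
              HurwitzZeta.expZeta ((-x : ℝ) : UnitAddCircle) t) +
          cexp (-π * I * s / 2) * cexp (π * I * t / 2) *
            (HurwitzZeta.expZeta (x : UnitAddCircle) s *
              HurwitzZeta.expZeta (x : UnitAddCircle) t) +
          cexp (π * I * s / 2) * cexp (-π * I * t / 2) *
            (HurwitzZeta.expZeta ((-x : ℝ) : UnitAddCircle) s *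
              HurwitzZeta.expZeta ((-x : ℝ) : UnitAddCircle) t) +
          cexp (π * I * s / 2) * cexp (π * I * t / 2) *
            (HurwitzZeta.expZeta ((-x : ℝ) : UnitAddCircle) s *
              HurwitzZeta.expZeta (x : UnitAddCircle) t)) := by
    have hx : ((1 - x : ℝ) : UnitAddCircle) = -(x : UnitAddCircle) := by
      rw [AddCircle.coe_sub, AddCircle.coe_period, zero_sub]
    rw [hx, hurwitzZeta_one_sub_of_one_lt_re _ hs, hurwitzZeta_one_sub_of_one_lt_re _ ht, neg_neg,
      AddCircle.coe_neg]
    ring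
  simp only [hprod]
  rw [intervalIntegral.integral_const_mul, intervalIntegral.integral_add,
    intervalIntegral.integral_add, intervalIntegral.integral_add,
    intervalIntegral.integral_const_mul, intervalIntegral.integral_const_mul,
    intervalIntegral.integral_const_mul, intervalIntegral.integral_const_mul, h1, h2, h3, h4,
    gammaBeta, show 1 - s + (1 - t) - 1 = 1 - (s + t) by ring, hfe, sub_sub_cancel,
    sub_sub_cancel, neg_add, cpow_add _ _ hpi]
  · generalize cexp (-π * I * s / 2) = u, cexp (-π * I * t / 2) = u', cexp (π * I * s / 2) = v,
      cexp (π * I * t / 2) = v' at hcos ⊢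
    field_simp
    linear_combination Gamma s * Gamma t * riemannZeta (s + t) * hcos
  all_goals exact Continuous.intervalIntegrable (by fun_prop) _ _

/-! ### The closed expression for negative real parts -/

theorem auxTerm_eq_taylorCoeff {a b : ℂ} (ha : ∀ k : ℤ, a ≠ k) (n : ℕ) :
    auxTerm a b n = taylorCoeff n a * (1 / ((n : ℂ) + 1 - b)) / (a - 1) := by
  have h : a + n ≠ 1 := fun h ↦ ha (1 - n) (by push_cast; linear_combination h)
  have h1 : a - 1 ≠ 0 := sub_ne_zero.mpr (by simpa using ha 1)
  rw [taylorCoeff_eq h, auxTerm]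
  field_simp

theorem hasSum_auxTerm_integral {a b : ℂ} (ha : a.re < 0) (hb : ∀ k : ℤ, b ≠ k) :
    HasSum (auxTerm b a)
      (∫ x in (0 : ℝ)..1, (x : ℂ) ^ (-a) * auxZeta b (1 - x)) := by
  have hg : Continuous fun x : ℝ ↦ (x : ℂ) ^ (-a) := continuous_ofReal_cpow_const (by simpa)
  have hb1 : b ≠ 1 := by simpa using hb 1
  have h := (hasSum_integral_taylorMap_mul b hg).div_const (b - 1)
  have hx1 : ∀ᵐ x : ℝ, x ≠ 1 := by simp [MeasureTheory.ae_iff, MeasureTheory.measure_singleton]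
  convert! h using 1
  · ext n
    rw [auxTerm_eq_taylorCoeff hb]
    congr 2
    have hre : -1 < ((n : ℂ) - a).re := by simp; linarith [n.cast_nonneg (α := ℝ)]
    have hne : (n : ℂ) - a + 1 ≠ 0 := fun h ↦ by
      have := congrArg re h
      simp at this hre
      linarith
    have := integral_cpow (a := 0) (b := 1) (r := n - a) (Or.inl hre)
    rw [ofReal_one, one_cpow, ofReal_zero, zero_cpow hne, sub_zero,
      sub_add_eq_add_sub] at this
    rw [← this]
    refine intervalIntegral.integral_congr_ae (.of_forall fun x hx ↦ ?_)
    rw [uIoc_of_le zero_le_one] at hx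
    rw [sub_eq_add_neg, cpow_add _ _ (by exact_mod_cast hx.1.ne'), cpow_natCast]
  · rw [← intervalIntegral.integral_div]
    refine intervalIntegral.integral_congr_ae ?_
    filter_upwards [hx1] with x hx1 hx
    rw [uIoc_of_le zero_le_one] at hx
    have hx' : x ∈ Icc (0 : ℝ) 1 := ⟨hx.1.le, hx.2⟩
    rw [projIcc_of_mem _ hx', auxZeta_eq_taylorMap hb1 (y := ⟨x, hx'⟩) ?_ (by simp)]
    · ring
    · exact ⟨sub_pos.mpr (lt_of_le_of_ne hx.2 hx1), by linarith [hx.1]⟩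

theorem gammaBeta_eq_integral {a b : ℂ} (ha : a.re < 0) (hb : b.re < 0) :
    ∫ x in (0 : ℝ)..1, (x : ℂ) ^ (-a) * ((1 - x : ℝ) : ℂ) ^ (-b) = gammaBeta (1 - a) (1 - b) := by
  have hG : Gamma (1 - a + (1 - b)) ≠ 0 := Gamma_ne_zero_of_re_pos (by simp; linarith)
  rw [gammaBeta, Gamma_mul_Gamma_eq_betaIntegral (by simp; linarith) (by simp; linarith),
    mul_div_cancel_left₀ _ hG, betaIntegral]
  simp

/-- Splitting both Hurwitz zeta functions in Mikolás' formula as `ζ(a, x) = ζ₁(a, x) + x ^ (-a)`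
gives the closed expression, when `Re a` and `Re b` are negative. -/
theorem auxIntegral_eq_auxClosed_of_re_neg {a b : ℂ} (ha : a.re < 0) (hb : b.re < 0)
    (ha' : ∀ k : ℤ, a ≠ k) (hb' : ∀ k : ℤ, b ≠ k) : auxIntegral a b = auxClosed a b := by
  have h1 := hasSum_auxTerm_integral ha hb'
  have h2 := hasSum_auxTerm_integral hb ha'
  have hr := intervalIntegral.integral_comp_sub_left (a := 0) (b := 1)
    (fun x : ℝ ↦ (x : ℂ) ^ (-b) * auxZeta a (1 - x)) 1
  simp only [sub_self, sub_zero, sub_sub_cancel] at hr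
  rw [← hr] at h2
  have hM := integral_hurwitzZeta_mul_hurwitzZeta ha hb
  have pa : Continuous fun x : ℝ ↦ (x : ℂ) ^ (-a) := continuous_ofReal_cpow_const (by simpa)
  have pb : Continuous fun x : ℝ ↦ ((1 - x : ℝ) : ℂ) ^ (-b) :=
    (continuous_ofReal_cpow_const (by simpa)).comp (continuous_const.sub continuous_id)
  have za : Continuous fun x : ℝ ↦ auxZeta a x := (continuous_hurwitzZeta_ofReal ha).sub pa
  have zb : Continuous fun x : ℝ ↦ auxZeta b (1 - x) :=
    ((continuous_hurwitzZeta_ofReal hb).comp (continuous_const.sub continuous_id)).sub pb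
  have hsplit (x : ℝ) : HurwitzZeta.hurwitzZeta (x : UnitAddCircle) a *
      HurwitzZeta.hurwitzZeta ((1 - x : ℝ) : UnitAddCircle) b =
      auxZeta a x * auxZeta b (1 - x) + (x : ℂ) ^ (-a) * auxZeta b (1 - x) +
        ((1 - x : ℝ) : ℂ) ^ (-b) * auxZeta a x + (x : ℂ) ^ (-a) * ((1 - x : ℝ) : ℂ) ^ (-b) := by
    rw [auxZeta, auxZeta]
    ring
  simp only [hsplit] at hM
  rw [intervalIntegral.integral_add, intervalIntegral.integral_add, intervalIntegral.integral_add,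
    gammaBeta_eq_integral ha hb, ← h1.tsum_eq, ← h2.tsum_eq] at hM
  · simp only [auxIntegral, auxIntegrand, auxClosed]
    linear_combination hM
  all_goals exact Continuous.intervalIntegrable (by fun_prop) _ _

/-! ### Continuation of the closed expression -/

theorem isClosed_range_intCast_complex : IsClosed (range ((↑) : ℤ → ℂ)) :=
  Complex.isClosedEmbedding_intCast.isClosed_range

/-- Near a non-integer, the distance to the integers is bounded below by a positive constant. -/
theorem exists_forall_norm_sub_intCast_ge {b : ℂ} (hb : ∀ k : ℤ, b ≠ k) :
    ∃ ε > 0, ∀ w ∈ Metric.ball b ε, ∀ k : ℤ, ε ≤ ‖k - w‖ := by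
  obtain ⟨ε, hε, h⟩ := Metric.isOpen_iff.mp isClosed_range_intCast_complex.isOpen_compl b
    (by rintro ⟨k, hk⟩; exact hb k hk.symm)
  refine ⟨ε / 2, half_pos hε, fun w hw k ↦ ?_⟩
  have hk : (k : ℂ) ∉ Metric.ball b ε := fun hk ↦ h hk ⟨k, rfl⟩
  rw [mem_ball_iff_norm] at hk hw
  have : ‖(k : ℂ) - b‖ ≤ ‖(k : ℂ) - w‖ + ‖w - b‖ := by
    simpa using norm_add_le ((k : ℂ) - w) (w - b)
  linarith

theorem norm_one_div_natCast_add_one_sub_le {w : ℂ} {ε : ℝ} (hε : 0 < ε)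
    (h : ∀ k : ℤ, ε ≤ ‖k - w‖) (n : ℕ) : ‖1 / ((n : ℂ) + 1 - w)‖ ≤ 1 / ε := by
  have := h (n + 1)
  push_cast at this
  rw [norm_div, norm_one]
  gcongr

theorem summable_auxTerm {a b : ℂ} (ha : ∀ k : ℤ, a ≠ k) (hb : ∀ k : ℤ, b ≠ k) :
    Summable (auxTerm a b) := by
  obtain ⟨ε, hε, h⟩ := exists_forall_norm_sub_intCast_ge hb
  have h1 : Summable fun n : ℕ ↦ taylorCoeff n a * (1 / ((n : ℂ) + 1 - b)) := by
    refine Summable.of_norm_bounded ((summable_norm_taylorCoeff a).mul_right (1 / ε)) fun n ↦ ?_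
    rw [norm_mul]
    exact mul_le_mul_of_nonneg_left (norm_one_div_natCast_add_one_sub_le hε
      (h b (Metric.mem_ball_self hε)) n) (norm_nonneg _)
  exact (summable_congr (auxTerm_eq_taylorCoeff ha)).mpr (h1.div_const _)

theorem differentiableAt_tsum_auxTerm_left {a b : ℂ} (ha : ∀ k : ℤ, a ≠ k) (hb : ∀ k : ℤ, b ≠ k) :
    DifferentiableAt ℂ (fun a ↦ ∑' n, auxTerm a b n) a := by
  obtain ⟨ε, hε, h⟩ := exists_forall_norm_sub_intCast_ge hb
  have hd := (differentiable_tsum_taylorCoeff_smul (fun n ↦ 1 / ((n : ℂ) + 1 - b))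
    (norm_one_div_natCast_add_one_sub_le hε (h b (Metric.mem_ball_self hε)))) a
  have h1 : a - 1 ≠ 0 := sub_ne_zero.mpr (by simpa using ha 1)
  refine (hd.div (differentiableAt_id.sub_const 1) h1).congr_of_eventuallyEq ?_
  filter_upwards [isClosed_range_intCast_complex.isOpen_compl.mem_nhds
    (by rintro ⟨k, hk⟩; exact ha k hk.symm : a ∈ (range ((↑) : ℤ → ℂ))ᶜ)] with w hw
  simp only [auxTerm_eq_taylorCoeff (a := w) fun k hk ↦ hw ⟨k, hk.symm⟩, tsum_div_const,
    Pi.div_apply, smul_eq_mul, id]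

theorem differentiableAt_tsum_auxTerm_right {a b : ℂ} (ha : ∀ k : ℤ, a ≠ k)
    (hb : ∀ k : ℤ, b ≠ k) : DifferentiableAt ℂ (fun a ↦ ∑' n, auxTerm b a n) a := by
  obtain ⟨ε, hε, h⟩ := exists_forall_norm_sub_intCast_ge ha
  simp only [auxTerm_eq_taylorCoeff hb, tsum_div_const]
  refine DifferentiableAt.div_const (DifferentiableOn.differentiableAt
    (Complex.differentiableOn_tsum_of_summable_norm (U := Metric.ball a ε)
      ((summable_norm_taylorCoeff b).mul_right (1 / ε)) (fun n w hw ↦ ?_) Metric.isOpen_ball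
      fun n w hw ↦ ?_) (Metric.ball_mem_nhds a hε)) _
  · have hne : (n : ℂ) + 1 - w ≠ 0 := fun h0 ↦ by
      have := h w hw (n + 1)
      push_cast at this
      rw [h0, norm_zero] at this
      linarith
    refine DifferentiableAt.differentiableWithinAt ?_
    fun_prop (disch := exact hne)
  · rw [norm_mul]
    gcongr
    exact norm_one_div_natCast_add_one_sub_le hε (h w hw) n

theorem differentiableAt_auxClosed_left {a b : ℂ} (ha : ∀ k : ℤ, a ≠ k) (hb : ∀ k : ℤ, b ≠ k)
    (hab : a + b ≠ 2) : DifferentiableAt ℂ (fun a ↦ auxClosed a b) a := by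
  refine ((DifferentiableAt.mul ?_ (DifferentiableAt.sub_const ?_ 1)).sub
    (differentiableAt_tsum_auxTerm_left ha hb)).sub (differentiableAt_tsum_auxTerm_right ha hb)
  · simp only [gammaBeta, div_eq_mul_inv]
    refine DifferentiableAt.mul (DifferentiableAt.mul_const ?_ _) ?_
    · refine DifferentiableAt.comp (g := Gamma) a (differentiableAt_Gamma _ fun m h ↦ ?_)
        (differentiableAt_id.const_sub 1)
      exact ha (1 + m) (by push_cast; linear_combination -h)
    · exact (differentiable_one_div_Gamma _).comp (f := fun a ↦ 1 - a + (1 - b)) a (by fun_prop)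
  · refine DifferentiableAt.comp (g := riemannZeta) a (differentiableAt_riemannZeta fun h ↦ hab ?_)
      ((differentiableAt_id.add_const b).sub_const 1)
    linear_combination h

theorem auxClosed_symm (a b : ℂ) : auxClosed a b = auxClosed b a := by
  simp only [auxClosed, gammaBeta]
  rw [mul_comm (Gamma (1 - a)), add_comm (1 - a), add_comm a]
  ring

theorem differentiableAt_auxIntegral_left {a b : ℂ} (ha : a ≠ 1) (hb : b ≠ 1) :
    DifferentiableAt ℂ (fun a ↦ auxIntegral a b) a := by
  have h1 : (a - 1) * (b - 1) ≠ 0 := mul_ne_zero (sub_ne_zero.mpr ha) (sub_ne_zero.mpr hb)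
  have h2 : DifferentiableAt ℂ (fun a ↦ regIntegral (a, b)) a :=
    (analyticAt_regIntegral (a, b)).differentiableAt.comp (f := fun a : ℂ ↦ (a, b)) a
      (by fun_prop)
  have h3 : DifferentiableAt ℂ (fun a ↦ regIntegral (a, b) / ((a - 1) * (b - 1))) a := by
    fun_prop (disch := exact h1)
  refine h3.congr_of_eventuallyEq ?_
  filter_upwards [isOpen_ne.mem_nhds ha] with w hw using auxIntegral_eq_regIntegral hw hb

/-- For fixed `b ∉ ℤ`, the exceptional values of `a` are countable and closed, so their complement
is connected, and the identity theorem in the one variable `a` applies. -/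
theorem auxIntegral_eq_auxClosed_of_forall_re_neg {b : ℂ} (hb : ∀ k : ℤ, b ≠ k)
    (h : ∀ a : ℂ, a.re < 0 → (∀ k : ℤ, a ≠ k) → a + b ≠ 2 → auxIntegral a b = auxClosed a b)
    {a : ℂ} (ha : ∀ k : ℤ, a ≠ k) (hab : a + b ≠ 2) : auxIntegral a b = auxClosed a b := by
  set S : Set ℂ := range ((↑) : ℤ → ℂ) ∪ {2 - b} with hS
  have hmem {w : ℂ} : w ∈ Sᶜ ↔ (∀ k : ℤ, w ≠ k) ∧ w + b ≠ 2 := by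
    simp only [hS, compl_union, mem_inter_iff, mem_compl_iff, mem_range, not_exists,
      mem_singleton_iff, eq_sub_iff_add_eq, ne_eq, eq_comm]
  have hopen : IsOpen Sᶜ := (isClosed_range_intCast_complex.union isClosed_singleton).isOpen_compl
  have hconn : IsPreconnected Sᶜ :=
    (((countable_range _).union (countable_singleton _)).isPathConnected_compl_of_one_lt_rank
      (by simp)).isConnected.isPreconnected
  -- A base point with negative real part whose imaginary part excludes both `z₀ ∈ ℤ` and `z₀ + b = 2`.
  set z₀ : ℂ := ⟨-1, |b.im| + 1⟩ with hz₀
  have hz : z₀ ∈ Sᶜ := by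
    refine hmem.mpr ⟨fun k hk ↦ ?_, fun h ↦ ?_⟩
    · have := congrArg im hk
      simp [hz₀] at this
      linarith [abs_nonneg b.im]
    · have := congrArg im h
      simp [hz₀] at this
      linarith [neg_abs_le b.im]
  refine AnalyticOnNhd.eqOn_of_preconnected_of_eventuallyEq (𝕜 := ℂ) (U := Sᶜ) (z₀ := z₀)
    (f := fun a ↦ auxIntegral a b) (g := fun a ↦ auxClosed a b)
    (DifferentiableOn.analyticOnNhd (fun w hw ↦ ?_) hopen)
    (DifferentiableOn.analyticOnNhd (fun w hw ↦ ?_) hopen) hconn hz ?_ (hmem.mpr ⟨ha, hab⟩)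
  · exact (differentiableAt_auxIntegral_left (by simpa using (hmem.mp hw).1 1)
      (by simpa using hb 1)).differentiableWithinAt
  · exact (differentiableAt_auxClosed_left (hmem.mp hw).1 hb
      (hmem.mp hw).2).differentiableWithinAt
  · filter_upwards [hopen.mem_nhds hz, (isOpen_lt continuous_re continuous_const).mem_nhds
      (show z₀.re < 0 by simp [hz₀])] with w hw hre
    exact h w hre (hmem.mp hw).1 (hmem.mp hw).2

theorem auxIntegral_eq_auxClosed {p : ℂ × ℂ} (hp : p ∈ regularPairs) :
    auxIntegral p.1 p.2 = auxClosed p.1 p.2 := by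
  obtain ⟨ha, hb, hab⟩ := hp
  refine auxIntegral_eq_auxClosed_of_forall_re_neg hb (fun a hre ha hab ↦ ?_) ha hab
  rw [auxIntegral_symm, auxClosed_symm]
  refine auxIntegral_eq_auxClosed_of_forall_re_neg ha (fun b hre' hb _ ↦ ?_) hb
    (by rwa [add_comm])
  exact auxIntegral_eq_auxClosed_of_re_neg hre' hre hb ha

theorem isOpen_regularPairs : IsOpen regularPairs := by
  have h : IsOpen (range ((↑) : ℤ → ℂ))ᶜ := isClosed_range_intCast_complex.isOpen_compl
  have h1 : regularPairs = (Prod.fst ⁻¹' (range ((↑) : ℤ → ℂ))ᶜ) ∩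
      ((Prod.snd ⁻¹' (range ((↑) : ℤ → ℂ))ᶜ) ∩ {p : ℂ × ℂ | p.1 + p.2 ≠ 2}) := by
    ext p
    simp [regularPairs, eq_comm]
  rw [h1]
  exact (h.preimage continuous_fst).inter ((h.preimage continuous_snd).inter
    (isOpen_ne_fun (by fun_prop) (by fun_prop)))

theorem isOpen_poleFree : IsOpen poleFree :=
  (isOpen_ne_fun continuous_fst continuous_const).inter
    (isOpen_ne_fun continuous_snd continuous_const)

theorem analyticOnNhd_auxIntegral :
    AnalyticOnNhd ℂ (fun p : ℂ × ℂ ↦ auxIntegral p.1 p.2) poleFree := by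
  intro p hp
  have h0 : (p.1 - 1) * (p.2 - 1) ≠ 0 :=
    mul_ne_zero (sub_ne_zero.mpr hp.1) (sub_ne_zero.mpr hp.2)
  have h1 : AnalyticAt ℂ (fun p : ℂ × ℂ ↦ (p.1 - 1) * (p.2 - 1)) p :=
    (analyticAt_fst.sub analyticAt_const).mul (analyticAt_snd.sub analyticAt_const)
  refine ((analyticAt_regIntegral p).div h1 h0).congr ?_
  filter_upwards [isOpen_poleFree.mem_nhds hp] with q hq
  exact (auxIntegral_eq_regIntegral hq.1 hq.2).symm

theorem mem_poleFree_of_mem_regularPairs {p : ℂ × ℂ} (hp : p ∈ regularPairs) : p ∈ poleFree :=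
  ⟨by simpa using hp.1 1, by simpa using hp.2.1 1⟩

theorem mem_regularPairs_of_re_mem_Ioo {a b : ℂ} (ha : 0 < a.re) (ha' : a.re < 1) (hb : 0 < b.re)
    (hb' : b.re < 1) : (a, b) ∈ regularPairs := by
  have h {z : ℂ} (h0 : 0 < z.re) (h1 : z.re < 1) (k : ℤ) : z ≠ k := by
    rintro rfl
    simp only [intCast_re] at h0 h1
    have h2 : 0 < k := by exact_mod_cast h0
    have h3 : k < 1 := by exact_mod_cast h1
    omega
  refine ⟨h ha ha', h hb hb', fun h ↦ ?_⟩
  have := congrArg re h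
  simp at this
  linarith

theorem mem_regularPairs_of_one_lt_re {a b : ℂ} (ha : 1 < a.re) (hb : 1 < b.re)
    (ha' : ∀ k : ℕ, a ≠ k) (hb' : ∀ k : ℕ, b ≠ k) : (a, b) ∈ regularPairs := by
  have h {z : ℂ} (h1 : 1 < z.re) (h' : ∀ k : ℕ, z ≠ k) (k : ℤ) : z ≠ k := by
    rintro rfl
    simp only [intCast_re] at h1
    have h2 : 1 < k := by exact_mod_cast h1
    obtain ⟨m, rfl⟩ := Int.eq_ofNat_of_zero_le (by omega : 0 ≤ k)
    exact h' m (by simp)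
  refine ⟨h ha ha', h hb hb', fun h ↦ ?_⟩
  have := congrArg re h
  simp at this
  linarith

theorem theorem3 :
    -- the evaluation for `0 < Re a, Re b < 1`
    (∀ a b : ℂ, 0 < a.re → a.re < 1 → 0 < b.re → b.re < 1 →
      IntervalIntegrable (auxIntegrand a b) MeasureTheory.volume 0 1 ∧
      Summable (auxTerm a b) ∧ Summable (auxTerm b a) ∧
      (∫ x in (0 : ℝ)..1, auxZeta a x * auxZeta b (1 - x)) =
        gammaBeta (1 - a) (1 - b) * (riemannZeta (a + b - 1) - 1)
          - (∑' n : ℕ, auxTerm a b n) - (∑' n : ℕ, auxTerm b a n)) ∧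
    -- the integral converges and is analytic in `(a, b)`, for `a, b ≠ 1`
    (∀ a b : ℂ, a ≠ 1 → b ≠ 1 →
      IntervalIntegrable (auxIntegrand a b) MeasureTheory.volume 0 1) ∧
    AnalyticOnNhd ℂ (fun p : ℂ × ℂ => auxIntegral p.1 p.2) poleFree ∧
    -- the closed expression is analytic, and equal to the integral, wherever all its parts are
    -- finite
    AnalyticOnNhd ℂ (fun p : ℂ × ℂ => auxClosed p.1 p.2) regularPairs ∧
    (∀ p ∈ regularPairs, Summable (auxTerm p.1 p.2) ∧ Summable (auxTerm p.2 p.1) ∧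
      auxIntegral p.1 p.2 = auxClosed p.1 p.2) ∧
    -- in particular for `Re a, Re b > 1` with `a, b` not integers
    (∀ a b : ℂ, 1 < a.re → 1 < b.re → (∀ k : ℕ, a ≠ k) → (∀ k : ℕ, b ≠ k) →
      auxIntegral a b = auxClosed a b) ∧
    -- its singularities off `a = 1` and `b = 1` are only apparent: the limit is the integral
    (∀ p ∈ poleFree, Filter.Tendsto (fun q : ℂ × ℂ => auxClosed q.1 q.2)
      (nhdsWithin p regularPairs) (nhds (auxIntegral p.1 p.2))) ∧
    -- at `a = 1` and at `b = 1` there is a genuine pole, namely that of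
    -- `F (a, b) / ((a - 1) (b - 1))` with `F` entire and nonzero there
    (∃ F : ℂ × ℂ → ℂ, AnalyticOnNhd ℂ F Set.univ ∧
      (∀ p ∈ poleFree, auxIntegral p.1 p.2 = F p / ((p.1 - 1) * (p.2 - 1))) ∧
      ∀ p : ℂ × ℂ, p.1 = 1 ∨ p.2 = 1 → F p ≠ 0) := by
  refine ⟨fun a b ha ha' hb hb' ↦ ?_, fun a b ha hb ↦ intervalIntegrable_auxIntegrand ha hb,
    analyticOnNhd_auxIntegral, fun p hp ↦ ?_, fun p hp ↦ ?_, fun a b ha hb ha' hb' ↦ ?_,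
    fun p hp ↦ ?_, regIntegral, fun p _ ↦ analyticAt_regIntegral p,
    fun p hp ↦ auxIntegral_eq_regIntegral hp.1 hp.2, ?_⟩
  · have hp := mem_regularPairs_of_re_mem_Ioo ha ha' hb hb'
    have hp' := mem_poleFree_of_mem_regularPairs hp
    exact ⟨intervalIntegrable_auxIntegrand hp'.1 hp'.2, summable_auxTerm hp.1 hp.2.1,
      summable_auxTerm hp.2.1 hp.1, auxIntegral_eq_auxClosed (p := (a, b)) hp⟩
  · -- The series need no analyticity in two variables: the identity transports that of `J`.
    refine (analyticOnNhd_auxIntegral p (mem_poleFree_of_mem_regularPairs hp)).congr ?_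
    filter_upwards [isOpen_regularPairs.mem_nhds hp] with q hq using auxIntegral_eq_auxClosed hq
  · exact ⟨summable_auxTerm hp.1 hp.2.1, summable_auxTerm hp.2.1 hp.1, auxIntegral_eq_auxClosed hp⟩
  · exact auxIntegral_eq_auxClosed (p := (a, b)) (mem_regularPairs_of_one_lt_re ha hb ha' hb')
  · have h : Tendsto (fun q : ℂ × ℂ ↦ auxIntegral q.1 q.2) (𝓝[regularPairs] p)
        (𝓝 (auxIntegral p.1 p.2)) :=
      (analyticOnNhd_auxIntegral p hp).continuousAt.tendsto.mono_left nhdsWithin_le_nhds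
    refine h.congr' ?_
    filter_upwards [self_mem_nhdsWithin] with q hq
    exact auxIntegral_eq_auxClosed hq
  · rintro ⟨a, b⟩ (rfl | rfl)
    · rw [regIntegral_symm, regIntegral_one_right]
      exact one_ne_zero
    · rw [regIntegral_one_right]
      exact one_ne_zero
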